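/- Let $(W_t)_{t\geq 0}$ be a standard scalar Brownian motion on a probability space $(\Omega,\mathcal A,\mathbb P)$. Then $$\liminf_{t\to\infty}\frac{\sup_{s\in[0,t]}|W_s|}{\sqrt{t/\ln(\ln t)}}=\frac{\pi}{\sqrt 8}\qquad \mathbb P\text{-almost surely.}$$ Moreover, write $\zeta(s)=\sum_{n=1}^\infty n^{-s}\in(0,\infty]$ for real $s$ (so $\zeta(s)=\infty$ for $s\leq 1$). For $q>1$ and $\varepsilon>0$ with $\varepsilon\neq 1$ let $$\mathcal O_{q,\varepsilon}=\#\Big\{n\in\{1,2,\dots\}\ :\ q^n>e,\ \frac{\sup_{s\in[0,q^n]}|W_s|}{\sqrt{q^n/\ln(\ln(q^n))}}<(1-\varepsilon)\frac{\pi}{\sqrt 8}\Big\}\in\{0,1,2,\dots\}\cup\{\infty\}.$$ Then for every $p<\frac{1}{(1-\varepsilon)^2}-1$ and every integer $k\geq 1$, $$\mathbb P(\mathcal O_{q,\varepsilon}\geq k)\leq \frac{24}{5\pi\,(\ln q)^{\frac{1}{(1-\varepsilon)^2}}}\cdot\max\Big\{\frac{\zeta\big(\frac{1}{(1-\varepsilon)^2}-p-1\big)}{(1-\varepsilon)^2\,k^{p+1}},\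 \frac{\zeta\big(\frac{1}{(1-\varepsilon)^2}\big)}{k}\Big\},$$ and if in addition $p>-1$, the same bound holds with $\min$ in place of $\max$. -/

import Mathlib

open MeasureTheory ProbabilityTheory Filter
open scoped NNReal ENNReal

/-- The running supremum `sup_{s ∈ [0, t]} |W(s)|` of a path. On a continuous path the family is
bounded, so that the real supremum is the genuine one. -/
noncomputable def runningSup {Ω : Type*} (W : ℝ≥0 → Ω → ℝ) (t : ℝ≥0) (ω : Ω) : ℝ :=
  ⨆ s : Set.Icc (0 : ℝ≥0) t, |W s ω|

/-- The normalized running supremum `sup_{s ∈ [0, t]} |W(s)| / √(t / ln ln t)`, meaningful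
for `t > e`. -/
noncomputable def chungRatio {Ω : Type*} (W : ℝ≥0 → Ω → ℝ) (t : ℝ≥0) (ω : Ω) : ℝ :=
  runningSup W t ω / Real.sqrt ((t : ℝ) / Real.log (Real.log (t : ℝ)))

/-- The number (possibly infinite) of indices `n ∈ {1, 2, …}` for which `ln ln (q ^ n) > 0` and
the normalized running supremum at time `q ^ n` lies below `(1 - ε) π / √8`. -/
noncomputable def deviationCount {Ω : Type*} (W : ℝ≥0 → Ω → ℝ) (q : ℝ≥0) (ε : ℝ) (ω : Ω) : ℕ∞ :=
  {n : ℕ | 1 ≤ n ∧ Real.exp 1 < (q : ℝ) ^ n ∧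
    chungRatio W (q ^ n) ω < (1 - ε) * (Real.pi / Real.sqrt 8)}.encard

/-- `ζ(s) = ∑_{n ≥ 1} n ^ (-s)` for real `s`, with values in `[0, ∞]`. As a sum of nonnegative
terms it equals `∞` for `s ≤ 1`. -/
noncomputable def zetaSeries (s : ℝ) : ℝ≥0∞ :=
  ∑' n : ℕ, ENNReal.ofReal (((n : ℝ) + 1) ^ (-s))

/-!
Both halves of the theorem rest on small ball estimates for `sup_{[0, T]} |W|`, with matching
exponents:
`exp (-π² T / (8 R²)) ≤ P (sup_{[0, T]} |W| < R) ≤ (3 / 2) exp (-π² T / (8 R²))`,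
where the supremum runs over the dyadic points of `[0, T]` (`exp_le_measureReal_dyadicBelow`,
`measureReal_dyadicBelow_le`). For a combination `h t x` of the heat solutions
`exp (-ν² t / 2) cos (ν x)`, the process `h (T - t) (W t)` is a martingale, so that
`h T 0 = E [h (T - τ) (W τ)]` with `τ` the first time of a dyadic grid at which `|W| ≥ R`,
or `T` if there is none. Path continuity makes the overshoot at `τ` vanish as the grid is refined.
The lower estimate comes from the single frequency `ν = π / (2 R)`, whose cosine vanishes at `±R`.
The upper estimate needs `h 0 ≥ 1` on `[-R, R]` and `h ≥ 0` on the boundary; the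
frequencies `1, 3, 4, 5` (times `π / (2 R)`) with coefficients `3 / 2, -1, 1, -3 / 8` do this, and the
leading coefficient obeys `3 / 2 ≤ 24 / (5 π)`.

For `R = r (π / √8) √(T / ln ln T)` the exponential is `(ln T) ^ (-1 / r²)`. At `T = q ^ n` and
`r = 1 - ε` this bounds the probability of the `n`-th deviation by a multiple of `n ^ (-a)` with
`a = 1 / (1 - ε)²`. Markov's inequality gives the bound with `ζ(a) / k`; the other bound holds because
`k` deviations force one with index at least `k`.

In the law of the iterated logarithm, the lower bound is the Borel–Cantelli lemma along `q ^ n`,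
followed by an interpolation that costs a factor `√q`. For the upper bound let
`t_n = exp (n ^ b)` with `b = r²`, `r > 1`. The increments over `[t_n, t_{n+1}]` are small with
probability at least `1 / (n + 1)`, and independently of each other, so that this happens infinitely
often; the path before `t_n` is negligible by the lower small ball estimate.
-/

/-! ### Martingales of cosine type, stopped on a grid -/

open Classical in
/-- The sequence `m`, stopped at the first index `k` with `R ≤ |x k|`, written as the sum of its
increments before that index. -/
noncomputable def stoppedSum (x : ℕ → ℝ) (R : ℝ) (m : ℕ → ℝ) : ℕ → ℝ
  | 0 => m 0
  | N + 1 => stoppedSum x R m N + if ∀ i ≤ N, |x i| < R then m (N + 1) - m N else 0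

lemma stoppedSum_cases (x : ℕ → ℝ) (R : ℝ) (m : ℕ → ℝ) (N : ℕ) :
    ((∀ i ≤ N, |x i| < R) ∧ stoppedSum x R m N = m N) ∨
      ∃ k ≤ N, (∀ i < k, |x i| < R) ∧ R ≤ |x k| ∧ stoppedSum x R m N = m k := by
  induction N with
  | zero =>
    rcases lt_or_ge |x 0| R with h | h
    · exact .inl ⟨by simpa using h, rfl⟩
    · exact .inr ⟨0, le_rfl, by simp, h, rfl⟩
  | succ N ih =>
    rcases ih with ⟨h1, h2⟩ | ⟨k, hk, h1, h2, h3⟩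
    · have h3 : stoppedSum x R m (N + 1) = m (N + 1) := by
        simp only [stoppedSum, if_pos h1, h2]
        ring
      rcases lt_or_ge |x (N + 1)| R with h | h
      · refine .inl ⟨fun i hi => ?_, h3⟩
        rcases Nat.le_succ_iff.1 hi with hi | rfl
        exacts [h1 i hi, h]
      · exact .inr ⟨N + 1, le_rfl, fun i hi => h1 i (Nat.lt_succ_iff.1 hi), h, h3⟩
    · refine .inr ⟨k, hk.trans N.le_succ, h1, h2, ?_⟩
      have : ¬ ∀ i ≤ N, |x i| < R := fun h => absurd (h k hk) (not_lt.2 h2)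
      simp only [stoppedSum, if_neg this, h3, add_zero]

/-- The solution `exp (-ν² t / 2) cos (ν x)` of the heat equation `∂ₜ h = ½ ∂ₓₓ h`. -/
noncomputable def heatCos (ν t x : ℝ) : ℝ := Real.exp (-(ν ^ 2 * t / 2)) * Real.cos (ν * x)

lemma abs_heatCos_le {ν t x : ℝ} (ht : 0 ≤ t) : |heatCos ν t x| ≤ 1 := by
  rw [heatCos, abs_mul, Real.abs_exp]
  have h1 : Real.exp (-(ν ^ 2 * t / 2)) ≤ 1 := Real.exp_le_one_iff.2 (by
    have : 0 ≤ ν ^ 2 * t / 2 := by positivity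
    linarith)
  exact mul_le_one₀ h1 (abs_nonneg _) (Real.abs_cos_le_one _)

lemma abs_heatCos_sub_le {ν t x y : ℝ} (hν : 0 ≤ ν) (ht : 0 ≤ t) :
    |heatCos ν t x - heatCos ν t y| ≤ ν * |x - y| := by
  rw [heatCos, heatCos, ← mul_sub, abs_mul, Real.abs_exp]
  have h1 : Real.exp (-(ν ^ 2 * t / 2)) ≤ 1 := Real.exp_le_one_iff.2 (by
    have : 0 ≤ ν ^ 2 * t / 2 := by positivity
    linarith)
  have h2 := Real.abs_cos_sub_cos_le (ν * x) (ν * y)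
  rw [← mul_sub, abs_mul, abs_of_nonneg hν] at h2
  calc _ ≤ 1 * |Real.cos (ν * x) - Real.cos (ν * y)| := by gcongr
    _ ≤ _ := by linarith

lemma continuous_heatCos (ν t : ℝ) : Continuous (heatCos ν t) := by
  unfold heatCos
  fun_prop

section

variable {Ω : Type*} [MeasurableSpace Ω] {P : Measure Ω} {W : ℝ≥0 → Ω → ℝ}

lemma integral_cexp_gaussian {X : Ω → ℝ} {d : ℝ≥0} (hX : HasLaw X (gaussianReal 0 d) P) (ν : ℝ) :
    ∫ ω, Complex.exp ((ν * X ω : ℝ) * Complex.I) ∂P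
      = (Real.exp (-(ν ^ 2 * d / 2)) : ℂ) := by
  have h := hX.integral_comp (f := fun x : ℝ => Complex.exp (ν * x * Complex.I))
    (by fun_prop)
  rw [← charFun_apply_real, charFun_gaussianReal] at h
  simp only [Function.comp_def] at h
  push_cast
  rw [h]
  congr 1
  push_cast
  ring

lemma integral_cos_gaussian [IsFiniteMeasure P] {X : Ω → ℝ} {d : ℝ≥0}
    (hX : HasLaw X (gaussianReal 0 d) P) (ν : ℝ) :
    ∫ ω, Real.cos (ν * X ω) ∂P = Real.exp (-(ν ^ 2 * d / 2)) ∧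
      ∫ ω, Real.sin (ν * X ω) ∂P = 0 := by
  have hm := hX.aemeasurable
  have hint : Integrable (fun ω => Complex.exp ((ν * X ω : ℝ) * Complex.I)) P := by
    refine Integrable.of_bound (C := 1) ?_ (ae_of_all _ fun ω => ?_)
    · exact (by fun_prop : AEMeasurable (fun ω => Complex.exp ((ν * X ω : ℝ) * Complex.I))
        P).aestronglyMeasurable
    · rw [Complex.norm_exp_ofReal_mul_I]
  have h := integral_cexp_gaussian hX ν
  constructor
  · have h1 := integral_re hint
    rw [h] at h1
    simpa [Complex.exp_ofReal_mul_I_re, -Complex.ofReal_mul, -Complex.ofReal_exp] using h1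
  · have h1 := integral_im hint
    rw [h] at h1
    simpa [Complex.exp_ofReal_mul_I_im, -Complex.ofReal_mul, -Complex.ofReal_exp] using h1

/-- The mean value property behind the cosine martingales: adding an independent `N(0, d)` variable
moves `heatCos` forward by the time `d`. -/
lemma integral_mul_heatCos_add [IsFiniteMeasure P] {J X D : Ω → ℝ} {d : ℝ≥0}
    (hJ : AEMeasurable J P) (hJb : ∀ ω, |J ω| ≤ 1) (hX : AEMeasurable X P)
    (hD : HasLaw D (gaussianReal 0 d) P) (hind : IndepFun (fun ω => (J ω, X ω)) D P) (ν t : ℝ) :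
    ∫ ω, J ω * heatCos ν t (X ω + D ω) ∂P = ∫ ω, J ω * heatCos ν (t + d) (X ω) ∂P := by
  obtain ⟨hc, hs⟩ := integral_cos_gaussian hD ν
  have hDm := hD.aemeasurable
  have hum : AEMeasurable (fun ω => J ω * Real.cos (ν * X ω)) P := by fun_prop
  have hvm : AEMeasurable (fun ω => J ω * Real.sin (ν * X ω)) P := by fun_prop
  have hcm : AEMeasurable (fun ω => Real.cos (ν * D ω)) P := by fun_prop
  have hsm : AEMeasurable (fun ω => Real.sin (ν * D ω)) P := by fun_prop
  have h1 : ∫ ω, J ω * Real.cos (ν * X ω) * Real.cos (ν * D ω) ∂P = _ :=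
    (hind.comp (φ := fun z : ℝ × ℝ => z.1 * Real.cos (ν * z.2)) (ψ := fun z => Real.cos (ν * z))
      (by fun_prop) (by fun_prop)).integral_fun_mul_eq_mul_integral
      hum.aestronglyMeasurable hcm.aestronglyMeasurable
  have h2 : ∫ ω, J ω * Real.sin (ν * X ω) * Real.sin (ν * D ω) ∂P = _ :=
    (hind.comp (φ := fun z : ℝ × ℝ => z.1 * Real.sin (ν * z.2)) (ψ := fun z => Real.sin (ν * z))
      (by fun_prop) (by fun_prop)).integral_fun_mul_eq_mul_integral
      hvm.aestronglyMeasurable hsm.aestronglyMeasurable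
  simp only [Function.comp_def] at h1 h2
  rw [hc] at h1
  rw [hs, mul_zero] at h2
  have hi1 : Integrable (fun ω => J ω * Real.cos (ν * X ω) * Real.cos (ν * D ω)) P :=
    Integrable.of_bound (hum.mul hcm).aestronglyMeasurable 1 (ae_of_all _ fun ω => by
      rw [norm_mul, norm_mul]
      exact mul_le_one₀ (mul_le_one₀ (hJb ω) (norm_nonneg _) (Real.abs_cos_le_one _))
        (norm_nonneg _) (Real.abs_cos_le_one _))
  have hi2 : Integrable (fun ω => J ω * Real.sin (ν * X ω) * Real.sin (ν * D ω)) P :=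
    Integrable.of_bound (hvm.mul hsm).aestronglyMeasurable 1 (ae_of_all _ fun ω => by
      rw [norm_mul, norm_mul]
      exact mul_le_one₀ (mul_le_one₀ (hJb ω) (norm_nonneg _) (Real.abs_sin_le_one _))
        (norm_nonneg _) (Real.abs_sin_le_one _))
  have h3 : ∀ ω, J ω * heatCos ν t (X ω + D ω) = Real.exp (-(ν ^ 2 * t / 2)) *
      (J ω * Real.cos (ν * X ω) * Real.cos (ν * D ω) -
        J ω * Real.sin (ν * X ω) * Real.sin (ν * D ω)) := fun ω => by
    rw [heatCos, mul_add, Real.cos_add]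
    ring
  have h4 : ∀ ω, J ω * heatCos ν (t + d) (X ω) = Real.exp (-(ν ^ 2 * t / 2)) *
      (Real.exp (-(ν ^ 2 * d / 2)) * (J ω * Real.cos (ν * X ω))) := fun ω => by
    rw [heatCos, mul_add, add_div, neg_add, Real.exp_add]
    ring
  simp_rw [h3, h4]
  rw [integral_const_mul, integral_sub hi1 hi2, h1, h2, sub_zero, integral_const_mul,
    integral_const_mul, mul_comm (∫ _, _ ∂P)]

/-- Optional stopping on a grid: the cosine martingale, stopped when `|W|` is first seen above
`R` on the grid, keeps its mean. -/
lemma integral_stoppedSum_heatCos (hW : IsPreBrownianReal W P) {t : ℕ → ℝ≥0} (ht : Monotone t)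
    (ht0 : t 0 = 0) (R ν T : ℝ) (N : ℕ) (hT : t N ≤ T) :
    Integrable (fun ω => stoppedSum (fun i => W (t i) ω) R
      (fun k => heatCos ν (T - t k) (W (t k) ω)) N) P ∧
    ∫ ω, stoppedSum (fun i => W (t i) ω) R
      (fun k => heatCos ν (T - t k) (W (t k) ω)) N ∂P = heatCos ν T 0 := by
  have := hW.isGaussianProcess.isProbabilityMeasure
  have hm : ∀ k, AEMeasurable (fun ω => heatCos ν (T - t k) (W (t k) ω)) P := fun k =>
    (continuous_heatCos _ _).measurable.comp_aemeasurable (hW.aemeasurable _)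
  induction N with
  | zero =>
    constructor
    · refine Integrable.of_bound (hm 0).aestronglyMeasurable 1 (ae_of_all _ fun ω => ?_)
      exact abs_heatCos_le (by linarith)
    · have : ∀ᵐ ω ∂P, heatCos ν (T - t 0) (W (t 0) ω) = heatCos ν T 0 := by
        filter_upwards [hW.eval_zero_ae_eq_zero] with ω h
        rw [ht0, h]
        simp
      simp only [stoppedSum]
      rw [integral_congr_ae this]
      simp
  | succ N ih =>
    have hN : (t N : ℝ) ≤ t (N + 1) := by exact_mod_cast ht N.le_succ
    obtain ⟨ih1, ih2⟩ := ih (hN.trans hT)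
    obtain ⟨d, hd⟩ := exists_add_of_le (ht N.le_succ)
    let A : Set (Set.Iic (t N) → ℝ) := {f | ∀ i, ∀ hi : i ≤ N, |f ⟨t i, ht hi⟩| < R}
    have hA : MeasurableSet A := by
      simp only [A, Set.ofPred_forall]
      exact .iInter fun i => .iInter fun _ => measurableSet_lt (by fun_prop) measurable_const
    have hAi : ∀ ω, A.indicator (fun _ => (1 : ℝ)) (fun s : Set.Iic (t N) => W s ω)
        = open Classical in if ∀ i ≤ N, |W (t i) ω| < R then 1 else 0 := fun ω => by
      simp [Set.indicator_apply, A]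
    have hAm : AEMeasurable (fun ω => A.indicator (fun _ => (1 : ℝ))
        (fun s : Set.Iic (t N) => W s ω)) P := by
      have hS : NullMeasurableSet {ω | ∀ i ≤ N, |W (t i) ω| < R} P := by
        simp only [Set.ofPred_forall]
        exact .iInter fun i => .iInter fun _ =>
          nullMeasurableSet_lt (hW.aemeasurable _).abs aemeasurable_const
      refine (aemeasurable_const (b := (1 : ℝ)).indicator₀ hS).congr (ae_of_all _ fun ω => ?_)
      simp only [hAi]
      simp [Set.indicator_apply]
    have hAb : ∀ ω, |A.indicator (fun _ => (1 : ℝ)) (fun s : Set.Iic (t N) => W s ω)| ≤ 1 := fun ω => by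
      rw [hAi]
      split_ifs <;> simp
    have hi : ∀ k, (t k : ℝ) ≤ T → Integrable (fun ω => A.indicator (fun _ => (1 : ℝ))
        (fun s : Set.Iic (t N) => W s ω) * heatCos ν (T - t k) (W (t k) ω)) P := fun k hk => by
      refine Integrable.of_bound (hAm.mul (hm k)).aestronglyMeasurable 1 (ae_of_all _ fun ω => ?_)
      rw [norm_mul]
      exact mul_le_one₀ (hAb ω) (norm_nonneg _) (abs_heatCos_le (by linarith))
    have hstep : ∀ ω, stoppedSum (fun i => W (t i) ω) R
        (fun k => heatCos ν (T - t k) (W (t k) ω)) (N + 1) =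
        stoppedSum (fun i => W (t i) ω) R (fun k => heatCos ν (T - t k) (W (t k) ω)) N +
        (A.indicator (fun _ => (1 : ℝ)) (fun s : Set.Iic (t N) => W s ω) *
          heatCos ν (T - t (N + 1)) (W (t (N + 1)) ω) -
          A.indicator (fun _ => (1 : ℝ)) (fun s : Set.Iic (t N) => W s ω) *
          heatCos ν (T - t N) (W (t N) ω)) := fun ω => by
      rw [hAi]
      simp only [stoppedSum]
      split_ifs <;> simp
    simp_rw [hstep]
    have hd' : t (N + 1) = t N + d := hd
    have hind : IndepFun (fun ω => (A.indicator (fun _ => (1 : ℝ))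
        (fun s : Set.Iic (t N) => W s ω), W (t N) ω)) (fun ω => W (t N + d) ω - W (t N) ω) P :=
      (hW.indepFun_shift (t N)).symm.comp
        (φ := fun f : Set.Iic (t N) → ℝ => (A.indicator (fun _ => (1 : ℝ)) f, f ⟨t N, le_refl (t N)⟩))
        (ψ := fun f : ℝ≥0 → ℝ => f d)
        ((measurable_const.indicator hA).prodMk (by fun_prop)) (by fun_prop)
    have hz := integral_mul_heatCos_add hAm hAb (hW.aemeasurable (t N))
      ((hW.shift (t N)).hasLaw_eval d) hind ν (T - t (N + 1))
    have hT' : T - t (N + 1) + d = T - t N := by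
      rw [hd', NNReal.coe_add]
      ring
    simp only [add_sub_cancel, hT', ← hd'] at hz
    have hi1 := hi (N + 1) hT
    have hi2 := hi N (hN.trans hT)
    have hi12 := hi1.sub hi2
    refine ⟨ih1.add hi12, (integral_add ih1 hi12).trans ?_⟩
    rw [ih2, add_eq_left]
    exact (integral_sub hi1 hi2).trans (sub_eq_zero.2 hz)

end

/-! ### Small ball probabilities -/

/-- The point `k / 2 ^ m` of the dyadic subdivision of `[0, T]`. -/
noncomputable def dyadicTime (T : ℝ≥0) (m k : ℕ) : ℝ≥0 := T * (k / 2 ^ m)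

/-- The paths that stay in `(-R, R)` at all dyadic points of `[0, T]`. Countably many coordinates
are involved, so that this set is measurable in the product σ-algebra. -/
def dyadicBelow (T : ℝ≥0) (R : ℝ) : Set (ℝ≥0 → ℝ) :=
  {f | ∀ m k, k ≤ 2 ^ m → |f (dyadicTime T m k)| < R}

lemma measurableSet_dyadicBelow (T : ℝ≥0) (R : ℝ) : MeasurableSet (dyadicBelow T R) := by
  simp only [dyadicBelow, Set.ofPred_forall]
  exact .iInter fun m => .iInter fun k => .iInter fun _ =>
    measurableSet_lt (by fun_prop) measurable_const

lemma monotone_dyadicTime (T : ℝ≥0) (m : ℕ) : Monotone (dyadicTime T m) := fun i j hij => by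
  unfold dyadicTime
  gcongr

@[simp] lemma dyadicTime_zero (T : ℝ≥0) (m : ℕ) : dyadicTime T m 0 = 0 := by simp [dyadicTime]

@[simp] lemma dyadicTime_two_pow (T : ℝ≥0) (m : ℕ) : dyadicTime T m (2 ^ m) = T := by
  simp [dyadicTime]

lemma dyadicTime_le {T : ℝ≥0} {m k : ℕ} (hk : k ≤ 2 ^ m) : dyadicTime T m k ≤ T :=
  (monotone_dyadicTime T m hk).trans_eq (dyadicTime_two_pow T m)

lemma dyadicTime_refine (T : ℝ≥0) {m n : ℕ} (h : m ≤ n) (k : ℕ) :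
    dyadicTime T n (k * 2 ^ (n - m)) = dyadicTime T m k := by
  obtain ⟨d, rfl⟩ := Nat.exists_eq_add_of_le h
  simp only [dyadicTime, Nat.add_sub_cancel_left]
  push_cast
  rw [pow_add, mul_div_mul_right _ _ (by positivity)]

/-- Off `dyadicBelow`, the exit is seen on every fine enough grid. -/
lemma eventually_exit_of_notMem {f : ℝ≥0 → ℝ} {T : ℝ≥0} {R : ℝ} (hf : f ∉ dyadicBelow T R) :
    ∀ᶠ m in atTop, ¬ ∀ i ≤ 2 ^ m, |f (dyadicTime T m i)| < R := by
  simp only [dyadicBelow, Set.mem_ofPred_eq, not_forall] at hf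
  obtain ⟨m, k, hk, h⟩ := hf
  filter_upwards [eventually_ge_atTop m] with n hn hall
  refine h ?_
  rw [← dyadicTime_refine T hn k]
  refine hall _ ?_
  calc k * 2 ^ (n - m) ≤ 2 ^ m * 2 ^ (n - m) := by gcongr
    _ = 2 ^ n := by rw [← pow_add, Nat.add_sub_cancel' hn]

/-- A continuous path overshoots the level `R` by less than `δ` at its exit time from `(-R, R)` on
a fine enough grid. -/
lemma eventually_overshoot_lt {f : ℝ≥0 → ℝ} (hf : Continuous f) (T : ℝ≥0) {R δ : ℝ}
    (h0 : |f 0| < R) (hδ : 0 < δ) :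
    ∀ᶠ m in atTop, ∀ k ≤ 2 ^ m, (∀ i < k, |f (dyadicTime T m i)| < R) →
      |f (dyadicTime T m k)| < R + δ := by
  have huc := isCompact_Icc.uniformContinuousOn_of_continuous (s := Set.Icc 0 T) hf.continuousOn
  rw [Metric.uniformContinuousOn_iff] at huc
  obtain ⟨r, hr, huc⟩ := huc δ hδ
  have hlim : Tendsto (fun m : ℕ => (T : ℝ) * (1 / 2) ^ m) atTop (nhds (T * 0)) :=
    (tendsto_pow_atTop_nhds_zero_of_lt_one (by norm_num) (by norm_num)).const_mul _
  rw [mul_zero] at hlim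
  filter_upwards [hlim.eventually (gt_mem_nhds hr)] with m hm k hk hi
  rcases k with _ | k
  · simpa using h0.trans (by linarith)
  have h1 := hi k k.lt_succ_self
  have h2 := huc (dyadicTime T m (k + 1)) ⟨zero_le, dyadicTime_le hk⟩ (dyadicTime T m k)
    ⟨zero_le, dyadicTime_le (k.le_succ.trans hk)⟩ (by
      rw [NNReal.dist_eq]
      have : ((dyadicTime T m (k + 1) : ℝ≥0) : ℝ) - (dyadicTime T m k : ℝ≥0)
          = T * (1 / 2) ^ m := by
        simp only [dyadicTime]
        push_cast
        rw [one_div_pow]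
        ring
      rwa [this, abs_of_nonneg (by positivity)])
  rw [Real.dist_eq] at h2
  have h3 := abs_sub_abs_le_abs_sub (f (dyadicTime T m (k + 1))) (f (dyadicTime T m k))
  linarith

/-- The cosine martingale stopped at the exit from `(-R, R)` on the `m`-th dyadic grid of
`[0, T]`. -/
noncomputable def stoppedCos {Ω : Type*} (W : ℝ≥0 → Ω → ℝ) (T : ℝ≥0) (R ν : ℝ) (m : ℕ) (ω : Ω) : ℝ :=
  stoppedSum (fun i => W (dyadicTime T m i) ω) R
    (fun k => heatCos ν (T - dyadicTime T m k) (W (dyadicTime T m k) ω)) (2 ^ m)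

/-- The exit alternative holds for all frequencies with the same index `k`. -/
lemma stoppedCos_cases {Ω : Type*} (W : ℝ≥0 → Ω → ℝ) (T : ℝ≥0) (R : ℝ) (m : ℕ) (ω : Ω) :
    ((∀ i ≤ 2 ^ m, |W (dyadicTime T m i) ω| < R) ∧
        ∀ ν, stoppedCos W T R ν m ω = heatCos ν 0 (W T ω)) ∨
      ∃ k ≤ 2 ^ m, (∀ i < k, |W (dyadicTime T m i) ω| < R) ∧ R ≤ |W (dyadicTime T m k) ω| ∧
        ∀ ν, stoppedCos W T R ν m ω
          = heatCos ν (T - dyadicTime T m k) (W (dyadicTime T m k) ω) := by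
  by_cases hall : ∀ i ≤ 2 ^ m, |W (dyadicTime T m i) ω| < R
  · refine .inl ⟨hall, fun ν => ?_⟩
    rcases stoppedSum_cases (fun i => W (dyadicTime T m i) ω) R
      (fun k => heatCos ν (T - dyadicTime T m k) (W (dyadicTime T m k) ω)) (2 ^ m) with
      ⟨-, h⟩ | ⟨k, hk, -, h, -⟩
    · rw [stoppedCos, h, dyadicTime_two_pow, sub_self]
    · exact absurd (hall k hk) (not_lt.2 h)
  · right
    push Not at hall
    classical
    have hk := Nat.find_spec hall
    refine ⟨Nat.find hall, hk.1, fun i hi => ?_, hk.2, fun ν => ?_⟩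
    · have := Nat.find_min hall hi
      push Not at this
      exact this (hi.le.trans hk.1)
    · rcases stoppedSum_cases (fun i => W (dyadicTime T m i) ω) R
        (fun k => heatCos ν (T - dyadicTime T m k) (W (dyadicTime T m k) ω)) (2 ^ m) with
        ⟨h, -⟩ | ⟨k, hk', h1, h2, h3⟩
      · exact absurd (h _ hk.1) (not_lt.2 hk.2)
      · have : Nat.find hall = k := by
          refine le_antisymm (Nat.find_min' hall ⟨hk', h2⟩) ?_
          by_contra! hlt
          exact absurd (h1 _ hlt) (not_lt.2 hk.2)
        rw [stoppedCos, h3, this]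

lemma abs_stoppedCos_le {Ω : Type*} (W : ℝ≥0 → Ω → ℝ) (T : ℝ≥0) (R ν : ℝ) (m : ℕ) (ω : Ω) :
    |stoppedCos W T R ν m ω| ≤ 1 := by
  rcases stoppedCos_cases W T R m ω with ⟨-, h⟩ | ⟨k, hk, -, -, h⟩
  · rw [h]
    exact abs_heatCos_le le_rfl
  · rw [h]
    have : (dyadicTime T m k : ℝ) ≤ T := by exact_mod_cast dyadicTime_le hk
    exact abs_heatCos_le (by linarith)

section

variable {Ω : Type*} [MeasurableSpace Ω] {P : Measure Ω} {W : ℝ≥0 → Ω → ℝ}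

/-- A Fatou type lemma: a bounded sequence of constant mean `c`, asymptotically nonnegative almost
surely, has `0 ≤ c`. -/
lemma nonneg_of_integral_eq_of_eventually [IsFiniteMeasure P] {Z : ℕ → Ω → ℝ} {C c : ℝ}
    (hZm : ∀ n, AEStronglyMeasurable (Z n) P) (hZb : ∀ n ω, |Z n ω| ≤ C)
    (hZc : ∀ n, ∫ ω, Z n ω ∂P = c)
    (hZ : ∀ᵐ ω ∂P, ∀ η > 0, ∀ᶠ n in atTop, -η ≤ Z n ω) : 0 ≤ c := by
  have hZi : ∀ n, Integrable (Z n) P := fun n =>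
    Integrable.of_bound (hZm n) C (ae_of_all _ (hZb n))
  have hlim : Tendsto (fun n => ∫ ω, min (Z n ω) 0 ∂P) atTop (nhds (∫ _, (0 : ℝ) ∂P)) := by
    refine tendsto_integral_of_dominated_convergence (fun _ => C)
      (fun n => (hZi n).inf (integrable_zero _ _ _) |>.aestronglyMeasurable)
      (integrable_const C) (fun n => ae_of_all _ fun ω => ?_) ?_
    · have := hZb n ω
      rw [abs_le] at this
      rw [Real.norm_eq_abs, abs_le]
      constructor
      · exact le_min (by linarith) (by linarith)
      · exact (min_le_right _ _).trans (by linarith)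
    · filter_upwards [hZ] with ω hω
      rw [Metric.tendsto_nhds]
      intro η hη
      filter_upwards [hω (η / 2) (by linarith)] with n hn
      rw [Real.dist_eq, sub_zero, abs_of_nonpos (min_le_right _ _)]
      have : -(η / 2) ≤ min (Z n ω) 0 := le_min hn (by linarith)
      linarith
  rw [integral_zero] at hlim
  refine le_of_tendsto hlim (Eventually.of_forall fun n => ?_)
  rw [← hZc n]
  exact integral_mono ((hZi n).inf (integrable_zero _ _ _)) (hZi n) fun ω => min_le_left _ _

lemma integral_stoppedCos (hW : IsPreBrownianReal W P) (T : ℝ≥0) (R ν : ℝ) (m : ℕ) :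
    Integrable (stoppedCos W T R ν m) P ∧
      ∫ ω, stoppedCos W T R ν m ω ∂P = Real.exp (-(ν ^ 2 * T / 2)) := by
  have := integral_stoppedSum_heatCos hW (monotone_dyadicTime T m) (dyadicTime_zero T m) R ν T
    (2 ^ m) (by simp)
  have h0 : heatCos ν T 0 = Real.exp (-(ν ^ 2 * T / 2)) := by simp [heatCos]
  rwa [h0] at this

lemma nullMeasurableSet_dyadicBelow (hW : IsPreBrownianReal W P) (T : ℝ≥0) (R : ℝ) :
    NullMeasurableSet {ω | (W · ω) ∈ dyadicBelow T R} P := by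
  have : {ω | (W · ω) ∈ dyadicBelow T R} =
      ⋂ (m : ℕ) (k : ℕ) (_ : k ≤ 2 ^ m), {ω | |W (dyadicTime T m k) ω| < R} := by
    ext ω
    simp [dyadicBelow]
  rw [this]
  exact .iInter fun m => .iInter fun k => .iInter fun _ =>
    nullMeasurableSet_lt (hW.aemeasurable _).abs aemeasurable_const

/-- The lower small ball estimate. The martingale of frequency `π / (2 R)` is at most `1` when the
path stays in `(-R, R)`, and at most `0` at an exit with an overshoot below `2 R`. -/
lemma exp_le_measureReal_dyadicBelow (hW : IsBrownianReal W P) (T : ℝ≥0) {R : ℝ} (hR : 0 < R) :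
    Real.exp (-(Real.pi ^ 2 * T / (8 * R ^ 2))) ≤ P.real {ω | (W · ω) ∈ dyadicBelow T R} := by
  have := hW.isGaussianProcess.isProbabilityMeasure
  set E := {ω | (W · ω) ∈ dyadicBelow T R} with hE
  have hEm : NullMeasurableSet E P := nullMeasurableSet_dyadicBelow hW.toIsPreBrownianReal T R
  set ν := Real.pi / (2 * R) with hν
  have hEi : Integrable (E.indicator fun _ => (1 : ℝ)) P :=
    (integrable_const 1).indicator₀ hEm
  have hEint : ∫ ω, E.indicator (fun _ => (1 : ℝ)) ω ∂P = P.real E := by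
    rw [integral_indicator₀ hEm]
    simp
  have hEb : ∀ ω, |E.indicator (fun _ => (1 : ℝ)) ω| ≤ 1 := fun ω => by
    by_cases h : ω ∈ E <;> simp [h]
  have key : 0 ≤ P.real E - Real.exp (-(ν ^ 2 * T / 2)) := by
    refine nonneg_of_integral_eq_of_eventually (P := P) (C := 2)
      (Z := fun m ω => E.indicator (fun _ => (1 : ℝ)) ω - stoppedCos W T R ν m ω)
      (fun m => (hEi.sub (integral_stoppedCos hW.toIsPreBrownianReal T R ν m).1).1)
      (fun m ω => ?_) (fun m => ?_) ?_
    · have h1 := abs_stoppedCos_le W T R ν m ω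
      have h2 := abs_sub (E.indicator (fun _ => (1 : ℝ)) ω) (stoppedCos W T R ν m ω)
      linarith [hEb ω]
    · rw [integral_sub hEi (integral_stoppedCos hW.toIsPreBrownianReal T R ν m).1, hEint,
        (integral_stoppedCos hW.toIsPreBrownianReal T R ν m).2]
    · filter_upwards [hW.cont, hW.eval_zero_ae_eq_zero] with ω hc h0 η hη
      by_cases hω : ω ∈ E
      · filter_upwards with m
        have := (abs_le.1 (abs_stoppedCos_le W T R ν m ω)).2
        simp only [Set.indicator_of_mem hω]
        linarith
      · filter_upwards [eventually_exit_of_notMem (f := (W · ω)) hω,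
          eventually_overshoot_lt hc T (R := R) (δ := 2 * R) (by simpa [h0] using hR)
            (by linarith)] with m h1 h2
        simp only [Set.indicator_of_notMem hω]
        rcases stoppedCos_cases W T R m ω with ⟨h, -⟩ | ⟨k, hk, hi, hk2, h⟩
        · exact absurd h h1
        · rw [h ν]
          have h3 := h2 k hk hi
          have h4 : heatCos ν (T - dyadicTime T m k) (W (dyadicTime T m k) ω) ≤ 0 := by
            rw [heatCos, ← Real.cos_abs, abs_mul]
            refine mul_nonpos_of_nonneg_of_nonpos (Real.exp_pos _).le ?_
            have hν0 : 0 < ν := by positivity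
            have hνR : ν * R = Real.pi / 2 := by
              rw [hν]
              field_simp
            rw [abs_of_pos hν0]
            refine Real.cos_nonpos_of_pi_div_two_le_of_le ?_ ?_
            · rw [← hνR]
              gcongr
            · calc _ ≤ ν * (R + 2 * R) := by gcongr
                _ = _ := by rw [mul_add, mul_left_comm, hνR]; ring
          linarith
  have h : ν ^ 2 * T / 2 = Real.pi ^ 2 * T / (8 * R ^ 2) := by
    rw [hν, div_pow]
    ring
  rw [← h]
  linarith

/-- The initial value of the barrier for the upper small ball estimate. In `u = cos y ∈ [0, 1]` the
difference of both sides is `u` times a quartic that is nonnegative on `[0, 1]`. -/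
lemma one_le_cosSum {y : ℝ} (hy : |y| ≤ Real.pi / 2) :
    1 ≤ 3 / 2 * Real.cos y - Real.cos (3 * y) + Real.cos (4 * y) - 3 / 8 * Real.cos (5 * y) := by
  have h0 : 0 ≤ Real.cos y := Real.cos_nonneg_of_mem_Icc (abs_le.1 hy)
  have h1 : Real.cos y ≤ 1 := Real.cos_le_one y
  have h4 : Real.cos (4 * y) = 2 * (2 * Real.cos y ^ 2 - 1) ^ 2 - 1 := by
    rw [← Real.cos_two_mul, ← Real.cos_two_mul]
    ring_nf
  have h5 : Real.cos (5 * y) = 2 * Real.cos (4 * y) * Real.cos y - Real.cos (3 * y) := by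
    have e1 : 5 * y = 4 * y + y := by ring
    have e2 : 3 * y = 4 * y - y := by ring
    rw [e1, e2, Real.cos_add, Real.cos_sub]
    ring
  rw [h5, h4, Real.cos_three_mul]
  generalize Real.cos y = u at h0 h1
  have key : 0 ≤ -6 * u ^ 4 + 8 * u ^ 3 + 7 / 2 * u ^ 2 - 8 * u + 21 / 8 := by
    nlinarith [mul_nonneg h0 (sub_nonneg.2 h1), sq_nonneg (u - 5 / 8), sq_nonneg (u - 7 / 10),
      sq_nonneg (u * (u - 5 / 8)), mul_nonneg (mul_nonneg h0 (sub_nonneg.2 h1))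
      (sq_nonneg (u - 5 / 8)), mul_nonneg (sub_nonneg.2 h1) (sq_nonneg (u - 5 / 8)),
      mul_nonneg h0 (sq_nonneg (u - 5 / 8))]
  have := mul_nonneg h0 key
  linarith

/-- The upper small ball estimate. The function
`h t x = ∑ b_j exp (-ν_j² t / 2) cos (ν_j x)`, `ν_j = j π / (2 R)`, with
`(b_1, b_3, b_4, b_5) = (3 / 2, -1, 1, -3 / 8)`, solves the heat equation; `h 0` is at least `1` on
`[-R, R]`, `h t (±R)` is positive, as only `j = 4` contributes there, and `h t 0` is at most
`(3 / 2) exp (-ν_1² t / 2)`. -/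
lemma measureReal_dyadicBelow_le (hW : IsBrownianReal W P) (T : ℝ≥0) {R : ℝ} (hR : 0 < R) :
    P.real {ω | (W · ω) ∈ dyadicBelow T R}
      ≤ 3 / 2 * Real.exp (-(Real.pi ^ 2 * T / (8 * R ^ 2))) := by
  have := hW.isGaussianProcess.isProbabilityMeasure
  have hpre := hW.toIsPreBrownianReal
  set E := {ω | (W · ω) ∈ dyadicBelow T R} with hE
  have hEm : NullMeasurableSet E P := nullMeasurableSet_dyadicBelow hpre T R
  set ν := Real.pi / (2 * R) with hν
  have hν0 : 0 < ν := by positivity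
  have hνR : ν * R = Real.pi / 2 := by
    rw [hν]
    field_simp
  have hEi : Integrable (E.indicator fun _ => (1 : ℝ)) P :=
    (integrable_const 1).indicator₀ hEm
  have hEint : ∫ ω, E.indicator (fun _ => (1 : ℝ)) ω ∂P = P.real E := by
    rw [integral_indicator₀ hEm]
    simp
  have hEb : ∀ ω, |E.indicator (fun _ => (1 : ℝ)) ω| ≤ 1 := fun ω => by
    by_cases h : ω ∈ E <;> simp [h]
  let Y : ℕ → Ω → ℝ := fun m ω => 3 / 2 * stoppedCos W T R ν m ω
    - stoppedCos W T R (3 * ν) m ω + stoppedCos W T R (4 * ν) m ω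
    - 3 / 8 * stoppedCos W T R (5 * ν) m ω
  have hs := fun m => integral_stoppedCos hpre T R ν m
  have hs3 := fun m => integral_stoppedCos hpre T R (3 * ν) m
  have hs4 := fun m => integral_stoppedCos hpre T R (4 * ν) m
  have hs5 := fun m => integral_stoppedCos hpre T R (5 * ν) m
  have hYi : ∀ m, Integrable (Y m) P := fun m =>
    ((((hs m).1.const_mul _).sub (hs3 m).1).add (hs4 m).1).sub ((hs5 m).1.const_mul _)
  have hYint : ∀ m, ∫ ω, Y m ω ∂P = 3 / 2 * Real.exp (-(ν ^ 2 * T / 2))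
      - Real.exp (-((3 * ν) ^ 2 * T / 2)) + Real.exp (-((4 * ν) ^ 2 * T / 2))
      - 3 / 8 * Real.exp (-((5 * ν) ^ 2 * T / 2)) := fun m => by
    have i1 := (hs m).1.const_mul (3 / 2)
    have i2 : Integrable (fun ω => 3 / 2 * stoppedCos W T R ν m ω
      - stoppedCos W T R (3 * ν) m ω) P := i1.sub (hs3 m).1
    have i3 : Integrable (fun ω => 3 / 2 * stoppedCos W T R ν m ω
      - stoppedCos W T R (3 * ν) m ω + stoppedCos W T R (4 * ν) m ω) P := i2.add (hs4 m).1
    have i4 := (hs5 m).1.const_mul (3 / 8)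
    rw [← (hs m).2, ← (hs3 m).2, ← (hs4 m).2, ← (hs5 m).2, ← integral_const_mul,
      ← integral_const_mul, ← integral_sub i1 (hs3 m).1, ← integral_add i2 (hs4 m).1,
      ← integral_sub i3 i4]
  have key : 0 ≤ (∫ ω, Y 0 ω ∂P) - P.real E := by
    refine nonneg_of_integral_eq_of_eventually (P := P) (C := 5)
      (Z := fun m ω => Y m ω - E.indicator (fun _ => (1 : ℝ)) ω)
      (fun m => ((hYi m).sub hEi).1) (fun m ω => ?_) (fun m => ?_) ?_
    · have h1 := abs_le.1 (abs_stoppedCos_le W T R ν m ω)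
      have h3 := abs_le.1 (abs_stoppedCos_le W T R (3 * ν) m ω)
      have h4 := abs_le.1 (abs_stoppedCos_le W T R (4 * ν) m ω)
      have h5 := abs_le.1 (abs_stoppedCos_le W T R (5 * ν) m ω)
      have h6 := abs_le.1 (hEb ω)
      rw [abs_le]
      constructor <;> simp only [Y] <;> linarith
    · rw [integral_sub (hYi m) hEi, hEint, hYint, hYint]
    · filter_upwards [hW.cont, hW.eval_zero_ae_eq_zero] with ω hc h0 η hη
      filter_upwards [eventually_overshoot_lt hc T (R := R) (δ := η / (20 * ν))
        (by simpa [h0] using hR) (by positivity)] with m hm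
      have hstay : ∀ {x : ℝ}, |x| ≤ R → 1 ≤ 3 / 2 * heatCos ν 0 x - heatCos (3 * ν) 0 x
          + heatCos (4 * ν) 0 x - 3 / 8 * heatCos (5 * ν) 0 x := fun {x} hx => by
        have := one_le_cosSum (y := ν * x) (by
          rw [abs_mul, abs_of_pos hν0, ← hνR]
          gcongr)
        simpa [heatCos, mul_assoc] using this
      rcases stoppedCos_cases W T R m ω with ⟨hi, h⟩ | ⟨k, hk, hi, hk2, h⟩
      · have h1 := hstay (x := W T ω) (by simpa using (hi (2 ^ m) le_rfl).le)
        have h2 := (abs_le.1 (hEb ω)).2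
        simp only [Y, h]
        linarith
      · have hω : ω ∉ E := fun hω => absurd (hω m k hk) (not_lt.2 hk2)
        simp only [Set.indicator_of_notMem hω, sub_zero, Y, h]
        have h3 := hm k hk hi
        set x := W (dyadicTime T m k) ω
        set r : ℝ := T - dyadicTime T m k
        have hr : 0 ≤ r := by
          have : (dyadicTime T m k : ℝ) ≤ T := by exact_mod_cast dyadicTime_le hk
          simp only [r]
          linarith
        have habs : ∀ μ, heatCos μ r x = heatCos μ r |x| := fun μ => by
          rw [heatCos, heatCos, ← Real.cos_abs (μ * x), abs_mul, ← Real.cos_abs (μ * |x|), abs_mul,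
            abs_abs]
        have hx : |(|x|) - R| ≤ η / (20 * ν) := by
          rw [abs_of_nonneg (by linarith)]
          linarith
        have hb : ∀ j : ℝ, 0 ≤ j →
            |heatCos (j * ν) r x - heatCos (j * ν) r R| ≤ j * (η / 20) := fun j hj => by
          rw [habs]
          refine (abs_heatCos_sub_le (by positivity) hr).trans ?_
          calc j * ν * |(|x|) - R| ≤ j * ν * (η / (20 * ν)) := by gcongr
            _ = _ := by field_simp
        have hR1 : heatCos (1 * ν) r R = 0 := by
          rw [heatCos, one_mul, hνR, Real.cos_pi_div_two, mul_zero]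
        have hR3 : heatCos (3 * ν) r R = 0 := by
          have : 3 * ν * R = Real.pi / 2 + Real.pi := by rw [mul_assoc, hνR]; ring
          rw [heatCos, this, Real.cos_add_pi, Real.cos_pi_div_two, neg_zero, mul_zero]
        have hR4 : 0 ≤ heatCos (4 * ν) r R := by
          have : 4 * ν * R = 2 * Real.pi := by rw [mul_assoc, hνR]; ring
          rw [heatCos, this, Real.cos_two_pi, mul_one]
          exact (Real.exp_pos _).le
        have hR5 : heatCos (5 * ν) r R = 0 := by
          have : 5 * ν * R = Real.pi / 2 + 2 * Real.pi := by rw [mul_assoc, hνR]; ring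
          rw [heatCos, this, Real.cos_add_two_pi, Real.cos_pi_div_two, mul_zero]
        have b1 := abs_le.1 (hb 1 (by norm_num))
        have b3 := abs_le.1 (hb 3 (by norm_num))
        have b4 := abs_le.1 (hb 4 (by norm_num))
        have b5 := abs_le.1 (hb 5 (by norm_num))
        rw [hR1, one_mul, one_mul] at b1
        rw [hR3] at b3
        rw [hR5] at b5
        linarith [b1.1, b3.2, b4.1, b5.2]
  have h : ν ^ 2 * T / 2 = Real.pi ^ 2 * T / (8 * R ^ 2) := by
    rw [hν, div_pow]
    ring
  rw [← h]
  rw [hYint] at key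
  have h43 : Real.exp (-((4 * ν) ^ 2 * T / 2)) ≤ Real.exp (-((3 * ν) ^ 2 * T / 2)) := by
    have : 0 ≤ ν ^ 2 * T := by positivity
    exact Real.exp_le_exp.2 (by nlinarith)
  linarith [Real.exp_pos (-((5 * ν) ^ 2 * T / 2))]

end

/-! ### The running supremum and small values of the normalized supremum -/

section

variable {Ω : Type*} {W : ℝ≥0 → Ω → ℝ} {ω : Ω}

lemma le_runningSup (hc : Continuous (W · ω)) {s t : ℝ≥0} (hst : s ≤ t) :
    |W s ω| ≤ runningSup W t ω := by
  have hb : BddAbove (Set.range fun s : Set.Icc (0 : ℝ≥0) t => |W s ω|) := by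
    have := (isCompact_Icc (a := (0 : ℝ≥0)) (b := t)).bddAbove_image
      (f := fun s => |W s ω|) hc.abs.continuousOn
    rwa [Set.image_eq_range] at this
  exact le_ciSup hb ⟨s, zero_le, hst⟩

lemma runningSup_le {t : ℝ≥0} {R : ℝ} (h : ∀ s ≤ t, |W s ω| ≤ R) : runningSup W t ω ≤ R := by
  have : Nonempty (Set.Icc (0 : ℝ≥0) t) := ⟨⟨0, le_rfl, zero_le⟩⟩
  exact ciSup_le fun s => h s s.2.2

lemma runningSup_nonneg (W : ℝ≥0 → Ω → ℝ) (t : ℝ≥0) (ω : Ω) : 0 ≤ runningSup W t ω :=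
  Real.iSup_nonneg fun _ => abs_nonneg _

lemma chungRatio_nonneg (W : ℝ≥0 → Ω → ℝ) (t : ℝ≥0) (ω : Ω) : 0 ≤ chungRatio W t ω :=
  div_nonneg (runningSup_nonneg W t ω) (Real.sqrt_nonneg _)

lemma mem_dyadicBelow_of_runningSup_lt (hc : Continuous (W · ω)) {T : ℝ≥0} {R : ℝ}
    (h : runningSup W T ω < R) : (W · ω) ∈ dyadicBelow T R :=
  fun _ _ hk => (le_runningSup hc (dyadicTime_le hk)).trans_lt h

lemma abs_le_of_mem_dyadicBelow {f : ℝ≥0 → ℝ} (hf : Continuous f) {T : ℝ≥0} {R : ℝ}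
    (h : f ∈ dyadicBelow T R) {s : ℝ≥0} (hs : s ≤ T) : |f s| ≤ R := by
  rcases eq_or_ne T 0 with rfl | hT
  · have := h 0 0 (by simp)
    rw [dyadicTime_zero] at this
    rw [nonpos_iff_eq_zero.1 hs]
    exact this.le
  have hT' : (T : ℝ) ≠ 0 := by exact_mod_cast hT
  let k : ℕ → ℕ := fun m => ⌊(s / T : ℝ) * 2 ^ m⌋₊
  have hlim : Tendsto (fun m => dyadicTime T m (k m)) atTop (nhds s) := by
    rw [← NNReal.tendsto_coe]
    have h1 := ((tendsto_nat_floor_mul_div_atTop (R := ℝ) (a := s / T) (by positivity)).comp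
      (tendsto_pow_atTop_atTop_of_one_lt (r := (2 : ℝ)) (by norm_num))).const_mul (T : ℝ)
    rw [mul_div_cancel₀ _ hT'] at h1
    refine h1.congr fun m => ?_
    simp [dyadicTime, k]
  refine le_of_tendsto ((hf.abs.tendsto s).comp hlim) (Eventually.of_forall fun m => (h m _ ?_).le)
  refine Nat.floor_le_of_le ?_
  push_cast
  have : (s / T : ℝ) ≤ 1 := div_le_one_of_le₀ (by exact_mod_cast hs) (by positivity)
  calc (s / T : ℝ) * 2 ^ m ≤ 1 * 2 ^ m := by gcongr
    _ = _ := one_mul _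

lemma runningSup_le_of_mem_dyadicBelow (hc : Continuous (W · ω)) {T : ℝ≥0} {R : ℝ}
    (h : (W · ω) ∈ dyadicBelow T R) : runningSup W T ω ≤ R :=
  runningSup_le fun _ hs => abs_le_of_mem_dyadicBelow hc h hs

end

/-- With the radius `r (π / √8) √(T / ln ln T)`, the exponent of the small ball estimates is
`ln ln T / r²`. -/
lemma exp_neg_chung_exponent {T r : ℝ} (hT : Real.exp 1 < T) (hr : 0 < r) :
    Real.exp (-(Real.pi ^ 2 * T / (8 * (r * (Real.pi / √8) * √(T / Real.log (Real.log T))) ^ 2)))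
      = Real.log T ^ (-(1 / r ^ 2)) := by
  have hT0 : 0 < T := (Real.exp_pos 1).trans hT
  have h1 : 1 < Real.log T := (Real.lt_log_iff_exp_lt hT0).2 hT
  have h2 : 0 < Real.log (Real.log T) := Real.log_pos h1
  rw [Real.rpow_def_of_pos (by linarith)]
  congr 1
  rw [mul_pow, mul_pow, div_pow, Real.sq_sqrt (by norm_num), Real.sq_sqrt (by positivity)]
  have := Real.pi_ne_zero
  field_simp

/-- The event behind the index `n` of `deviationCount`. -/
def deviationEvent {Ω : Type*} (W : ℝ≥0 → Ω → ℝ) (q : ℝ≥0) (ε : ℝ) (n : ℕ) : Set Ω :=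
  {ω | 1 ≤ n ∧ Real.exp 1 < (q : ℝ) ^ n ∧
    chungRatio W (q ^ n) ω < (1 - ε) * (Real.pi / √8)}

lemma deviationEvent_zero {Ω : Type*} (W : ℝ≥0 → Ω → ℝ) (q : ℝ≥0) (ε : ℝ) : deviationEvent W q ε 0 = ∅ := by
  simp [deviationEvent]

section

variable {Ω : Type*} [MeasurableSpace Ω] {P : Measure Ω} {W : ℝ≥0 → Ω → ℝ}

lemma measure_chungRatio_lt_le (hW : IsBrownianReal W P) {T : ℝ≥0} (hT : Real.exp 1 < T) {r : ℝ}
    (hr : 0 < r) :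
    P {ω | chungRatio W T ω < r * (Real.pi / √8)}
      ≤ ENNReal.ofReal (3 / 2 * Real.log T ^ (-(1 / r ^ 2))) := by
  have := hW.isGaussianProcess.isProbabilityMeasure
  have hT0 : (0 : ℝ) < T := (Real.exp_pos 1).trans hT
  have h1 : 1 < Real.log T := (Real.lt_log_iff_exp_lt hT0).2 hT
  have h2 : 0 < Real.log (Real.log T) := Real.log_pos h1
  have hs : 0 < √((T : ℝ) / Real.log (Real.log T)) := by positivity
  set R := r * (Real.pi / √8) * √((T : ℝ) / Real.log (Real.log T)) with hRdef
  have hR : 0 < R := by positivity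
  have hsub : {ω | chungRatio W T ω < r * (Real.pi / √8)} ≤ᵐ[P]
      {ω | (W · ω) ∈ dyadicBelow T R} := by
    filter_upwards [hW.cont] with ω hc h
    refine mem_dyadicBelow_of_runningSup_lt hc ?_
    exact (div_lt_iff₀ hs).1 h
  refine (measure_mono_ae hsub).trans ?_
  rw [← ofReal_measureReal]
  refine ENNReal.ofReal_le_ofReal ?_
  rw [← exp_neg_chung_exponent hT hr]
  exact measureReal_dyadicBelow_le hW T hR

/-! ### The number of deviations -/

/-- Markov's inequality for the number of events that occur, without measurability. -/
lemma measure_le_encard_le {A : ℕ → Set Ω} {k : ℕ} (hk : 1 ≤ k) :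
    P {ω | (k : ℕ∞) ≤ {n | ω ∈ A n}.encard} ≤ (∑' n, P (A n)) / k := by
  let f : Ω → ℝ≥0∞ := fun ω => ∑' n, (toMeasurable P (A n)).indicator 1 ω
  have hf : Measurable f := Measurable.tsum fun n =>
    measurable_one.indicator (measurableSet_toMeasurable P (A n))
  have hint : ∫⁻ ω, f ω ∂P = ∑' n, P (A n) := by
    rw [lintegral_tsum fun n =>
      (measurable_one.indicator (measurableSet_toMeasurable P (A n))).aemeasurable]
    simp [lintegral_indicator_one (measurableSet_toMeasurable P (A _))]
  rw [← hint]
  refine (measure_mono fun ω hω => ?_).trans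
    (meas_ge_le_lintegral_div hf.aemeasurable (ε := (k : ℝ≥0∞))
      (by simpa using (by omega : k ≠ 0)) (ENNReal.natCast_ne_top k))
  obtain ⟨t, ht, htk⟩ := Set.exists_subset_encard_eq (show (k : ℕ∞) ≤ _ from hω)
  have htf : t.Finite := Set.finite_of_encard_eq_coe htk
  have hcard : htf.toFinset.card = k := by
    rw [htf.encard_eq_coe_toFinset_card] at htk
    exact_mod_cast htk
  calc (k : ℝ≥0∞) = ∑ n ∈ htf.toFinset, 1 := by simp [hcard]
    _ = ∑ n ∈ htf.toFinset, (toMeasurable P (A n)).indicator 1 ω := by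
        refine Finset.sum_congr rfl fun n hn => ?_
        have : ω ∈ A n := ht (htf.mem_toFinset.1 hn)
        rw [Set.indicator_of_mem (subset_toMeasurable P _ this), Pi.one_apply]
    _ ≤ f ω := ENNReal.sum_le_tsum _

lemma measure_deviationEvent_le (hW : IsBrownianReal W P) {q : ℝ≥0} (hq : 1 < q) {ε : ℝ}
    (hε1 : ε < 1) (n : ℕ) :
    P (deviationEvent W q ε (n + 1))
      ≤ ENNReal.ofReal (24 / (5 * Real.pi * Real.log (q : ℝ) ^ (1 / (1 - ε) ^ 2)))
        * ENNReal.ofReal (((n : ℝ) + 1) ^ (-(1 / (1 - ε) ^ 2))) := by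
  by_cases hn : Real.exp 1 < (q : ℝ) ^ (n + 1)
  swap
  · have : deviationEvent W q ε (n + 1) = ∅ := by
      ext ω
      simp only [deviationEvent, Set.mem_ofPred_eq, Set.mem_empty_iff_false, iff_false]
      exact fun h => hn h.2.1
    simp [this]
  have hlq : 0 < Real.log (q : ℝ) := Real.log_pos (by exact_mod_cast hq)
  have h1 := measure_chungRatio_lt_le hW (T := q ^ (n + 1)) (by simpa using hn) (r := 1 - ε)
    (by linarith)
  refine (measure_mono fun ω h => h.2.2).trans (h1.trans ?_)
  rw [← ENNReal.ofReal_mul (by positivity)]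
  refine ENNReal.ofReal_le_ofReal ?_
  set a := 1 / (1 - ε) ^ 2
  rw [NNReal.coe_pow, Real.log_pow, Real.mul_rpow (by positivity) hlq.le,
    Real.rpow_neg hlq.le a]
  push_cast
  have hpos : 0 < Real.log (q : ℝ) ^ a := Real.rpow_pos_of_pos hlq a
  have hc : (3 / 2 : ℝ) ≤ 24 / (5 * Real.pi) := by
    rw [le_div_iff₀ (by positivity)]
    linarith [Real.pi_lt_d2]
  calc 3 / 2 * (((n : ℝ) + 1) ^ (-a) * (Real.log (q : ℝ) ^ a)⁻¹)
      ≤ 24 / (5 * Real.pi) * (((n : ℝ) + 1) ^ (-a) * (Real.log (q : ℝ) ^ a)⁻¹) := by gcongr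
    _ = _ := by
      field_simp

lemma measure_le_deviationCount_le (hW : IsBrownianReal W P) {q : ℝ≥0} (hq : 1 < q) {ε : ℝ}
    (hε1 : ε < 1) {k : ℕ} (hk : 1 ≤ k) :
    P {ω | (k : ℕ∞) ≤ deviationCount W q ε ω}
      ≤ ENNReal.ofReal (24 / (5 * Real.pi * Real.log (q : ℝ) ^ (1 / (1 - ε) ^ 2)))
        * (zetaSeries (1 / (1 - ε) ^ 2) / (k : ℝ≥0∞)) := by
  refine (measure_le_encard_le (A := deviationEvent W q ε) hk).trans ?_
  rw [← mul_div_assoc]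
  gcongr
  rw [tsum_eq_zero_add' ENNReal.summable, deviationEvent_zero, measure_empty, zero_add, zetaSeries,
    ← ENNReal.tsum_mul_left]
  exact ENNReal.tsum_le_tsum fun n => measure_deviationEvent_le hW hq hε1 n

/-- At least `k` deviations force a deviation with index at least `k`; for such indices `n` the
factor `n ^ (-(p + 1))` is at most `k ^ (-(p + 1))`. -/
lemma measure_le_deviationCount_le' (hW : IsBrownianReal W P) {q : ℝ≥0} (hq : 1 < q) {ε p : ℝ}
    (hε0 : 0 < ε) (hε1 : ε < 1) (hp : -1 < p) {k : ℕ} (hk : 1 ≤ k) :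
    P {ω | (k : ℕ∞) ≤ deviationCount W q ε ω}
      ≤ ENNReal.ofReal (24 / (5 * Real.pi * Real.log (q : ℝ) ^ (1 / (1 - ε) ^ 2)))
        * (zetaSeries (1 / (1 - ε) ^ 2 - p - 1)
            / ENNReal.ofReal ((1 - ε) ^ 2 * (k : ℝ) ^ (p + 1))) := by
  have hk0 : (0 : ℝ) < k := by exact_mod_cast hk
  have hkp : 0 < (k : ℝ) ^ (p + 1) := Real.rpow_pos_of_pos hk0 _
  set a := 1 / (1 - ε) ^ 2 with ha
  set K := ENNReal.ofReal (24 / (5 * Real.pi * Real.log (q : ℝ) ^ a)) with hK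
  have hsub : {ω | (k : ℕ∞) ≤ deviationCount W q ε ω} ⊆
      ⋃ n, {ω | k ≤ n + 1 ∧ ω ∈ deviationEvent W q ε (n + 1)} := fun ω hω => by
    by_contra hcon
    simp only [Set.mem_iUnion, Set.mem_ofPred_eq, not_exists, not_and] at hcon
    have hsubset : {n | ω ∈ deviationEvent W q ε n} ⊆ (Finset.Ico 1 k : Set ℕ) := fun n hn => by
      have hn1 : 1 ≤ n := hn.1
      obtain ⟨m, rfl⟩ := Nat.exists_eq_add_of_le' hn1
      rw [Finset.coe_Ico]
      exact ⟨hn1, not_le.1 fun h => hcon m h hn⟩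
    have h1 := Set.encard_le_encard hsubset
    rw [Set.encard_coe_eq_coe_finsetCard, Nat.card_Ico] at h1
    have h2 : (k : ℕ∞) ≤ ((k - 1 : ℕ) : ℕ∞) := le_trans hω h1
    have : k ≤ k - 1 := by exact_mod_cast h2
    omega
  have hbound : ∀ n : ℕ, P {ω | k ≤ n + 1 ∧ ω ∈ deviationEvent W q ε (n + 1)} ≤
      K * (ENNReal.ofReal (((n : ℝ) + 1) ^ (-(a - p - 1))) / ENNReal.ofReal ((k : ℝ) ^ (p + 1))) :=
      fun n => by
    by_cases hkn : k ≤ n + 1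
    swap
    · simp [hkn]
    refine (measure_mono fun ω h => h.2).trans ((measure_deviationEvent_le hW hq hε1 n).trans ?_)
    rw [← ENNReal.ofReal_div_of_pos hkp]
    refine mul_le_mul_right (ENNReal.ofReal_le_ofReal ?_) _
    rw [le_div_iff₀ hkp]
    have hkn' : (k : ℝ) ≤ n + 1 := by exact_mod_cast hkn
    calc ((n : ℝ) + 1) ^ (-a) * (k : ℝ) ^ (p + 1)
        ≤ ((n : ℝ) + 1) ^ (-a) * ((n : ℝ) + 1) ^ (p + 1) := by
          gcongr
          linarith
      _ = _ := by
          rw [← Real.rpow_add (by positivity)]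
          ring_nf
  calc _ ≤ ∑' n : ℕ, P {ω | k ≤ n + 1 ∧ ω ∈ deviationEvent W q ε (n + 1)} :=
        (measure_mono hsub).trans (measure_iUnion_le _)
    _ ≤ ∑' n : ℕ, K * (ENNReal.ofReal (((n : ℝ) + 1) ^ (-(a - p - 1)))
          / ENNReal.ofReal ((k : ℝ) ^ (p + 1))) := ENNReal.tsum_le_tsum hbound
    _ = K * (zetaSeries (a - p - 1) / ENNReal.ofReal ((k : ℝ) ^ (p + 1))) := by
        simp only [div_eq_mul_inv, zetaSeries]
        rw [ENNReal.tsum_mul_left, ENNReal.tsum_mul_right]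
    _ ≤ _ := by
        gcongr
        have h1 : (1 - ε) ^ 2 ≤ 1 := pow_le_one₀ (by linarith) (by linarith)
        calc (1 - ε) ^ 2 * (k : ℝ) ^ (p + 1) ≤ 1 * (k : ℝ) ^ (p + 1) := by gcongr
          _ = _ := one_mul _

/-- For `ε > 1` the threshold is negative, and no deviation occurs. -/
lemma measure_le_deviationCount_of_one_lt (q : ℝ≥0) {ε : ℝ} (hε : 1 < ε) {k : ℕ} (hk : 1 ≤ k) :
    P {ω | (k : ℕ∞) ≤ deviationCount W q ε ω} = 0 := by
  have h0 : ∀ ω, deviationCount W q ε ω = 0 := fun ω => by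
    rw [deviationCount, Set.encard_eq_zero, Set.eq_empty_iff_forall_notMem]
    rintro n ⟨-, -, h⟩
    have h1 : (1 - ε) * (Real.pi / √8) ≤ 0 :=
      mul_nonpos_of_nonpos_of_nonneg (by linarith) (by positivity)
    linarith [chungRatio_nonneg W (q ^ n) ω]
  have : {ω | (k : ℕ∞) ≤ deviationCount W q ε ω} = ∅ := by
    ext ω
    simp only [h0, Set.mem_ofPred_eq, Set.mem_empty_iff_false, iff_false, nonpos_iff_eq_zero]
    exact_mod_cast (by omega : k ≠ 0)
  rw [this, measure_empty]

end

/-! ### The lower bound of the limit inferior -/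

lemma eventually_of_eventually_succ {p : ℕ → Prop} (h : ∀ᶠ n in atTop, p (n + 1)) :
    ∀ᶠ n in atTop, p n := by
  rw [← map_add_atTop_eq_nat 1]
  exact h

lemma zetaSeries_ne_top {a : ℝ} (ha : 1 < a) : zetaSeries a ≠ ∞ := by
  have h : Summable fun n : ℕ => ((n : ℝ) + 1) ^ (-a) := by
    have := (summable_nat_add_iff 1).2 (Real.summable_nat_rpow.2 (by linarith : -a < -1))
    simpa using this
  exact h.tsum_ofReal_ne_top

/-- Between consecutive powers of `q`, the normalization grows by a factor at most `√q`. -/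
lemma eventually_div_sqrt_le_chungRatio {Ω : Type*} {W : ℝ≥0 → Ω → ℝ} {ω : Ω}
    (hc : Continuous (W · ω)) {q : ℝ≥0} (hq : 1 < q) {x : ℝ} (hx : 0 ≤ x)
    (h : ∀ᶠ n : ℕ in atTop, x ≤ chungRatio W (q ^ n) ω) :
    ∀ᶠ t : ℝ≥0 in atTop, x / √(q : ℝ) ≤ chungRatio W t ω := by
  have hq' : (1 : ℝ) < q := by exact_mod_cast hq
  have hlarge : ∀ᶠ n : ℕ in atTop, Real.exp 1 < (q : ℝ) ^ n :=
    (tendsto_pow_atTop_atTop_of_one_lt hq').eventually_gt_atTop _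
  obtain ⟨N, hN⟩ := eventually_atTop.1 (h.and hlarge)
  filter_upwards [eventually_ge_atTop (q ^ N)] with t ht
  have ht' : (q : ℝ) ^ N ≤ t := by exact_mod_cast ht
  obtain ⟨n, hn1, hn2⟩ := exists_nat_pow_near ((one_le_pow₀ hq'.le).trans ht') hq'
  have hNn : N ≤ n := by
    have := (pow_lt_pow_iff_right₀ hq').1 (ht'.trans_lt hn2)
    omega
  obtain ⟨h1, h2⟩ := hN n hNn
  have hqn : (0 : ℝ) < (q : ℝ) ^ n := by positivity
  have hl1 : 1 < Real.log ((q : ℝ) ^ n) := (Real.lt_log_iff_exp_lt hqn).2 h2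
  have hl2 : 0 < Real.log (Real.log ((q : ℝ) ^ n)) := Real.log_pos hl1
  have hl3 : Real.log (Real.log ((q : ℝ) ^ n)) ≤ Real.log (Real.log t) :=
    Real.log_le_log (by linarith) (Real.log_le_log hqn hn1)
  have hs : 0 < √((q : ℝ) ^ n / Real.log (Real.log ((q : ℝ) ^ n))) := by positivity
  have ht0 : (0 : ℝ) < t := hqn.trans_le hn1
  have hst : 0 < √((t : ℝ) / Real.log (Real.log t)) :=
    Real.sqrt_pos.2 (div_pos ht0 (hl2.trans_le hl3))
  rw [chungRatio, NNReal.coe_pow, le_div_iff₀ hs] at h1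
  rw [chungRatio, le_div_iff₀ hst]
  have hmono : runningSup W (q ^ n) ω ≤ runningSup W t ω := runningSup_le fun s hs =>
    le_runningSup hc (hs.trans (by exact_mod_cast hn1))
  refine le_trans ?_ (h1.trans hmono)
  have hcmp : √((t : ℝ) / Real.log (Real.log t))
      ≤ √(q : ℝ) * √((q : ℝ) ^ n / Real.log (Real.log ((q : ℝ) ^ n))) := by
    rw [← Real.sqrt_mul (by positivity), ← mul_div_assoc, ← pow_succ']
    exact Real.sqrt_le_sqrt (div_le_div₀ (by positivity) hn2.le hl2 hl3)
  have hsq : 0 < √(q : ℝ) := Real.sqrt_pos.2 (by linarith)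
  calc x / √(q : ℝ) * √((t : ℝ) / Real.log (Real.log t))
      ≤ x / √(q : ℝ) * (√(q : ℝ) * √((q : ℝ) ^ n / Real.log (Real.log ((q : ℝ) ^ n)))) := by
        gcongr
    _ = _ := by field_simp

section

variable {Ω : Type*} [MeasurableSpace Ω] {P : Measure Ω} {W : ℝ≥0 → Ω → ℝ}

lemma ae_eventually_le_chungRatio (hW : IsBrownianReal W P) {q : ℝ≥0} (hq : 1 < q) {ε : ℝ}
    (hε0 : 0 < ε) (hε1 : ε < 1) :
    ∀ᵐ ω ∂P, ∀ᶠ t : ℝ≥0 in atTop,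
      (1 - ε) * (Real.pi / √8) / √(q : ℝ) ≤ chungRatio W t ω := by
  have ha : 1 < 1 / (1 - ε) ^ 2 := by
    rw [one_lt_div (pow_pos (by linarith) 2)]
    exact pow_lt_one₀ (by linarith) (by linarith) two_ne_zero
  have hsum : ∑' n, P (deviationEvent W q ε (n + 1)) ≠ ∞ := by
    refine ne_top_of_le_ne_top ?_ (ENNReal.tsum_le_tsum fun n =>
      measure_deviationEvent_le hW hq hε1 n)
    rw [ENNReal.tsum_mul_left]
    exact ENNReal.mul_ne_top ENNReal.ofReal_ne_top (zetaSeries_ne_top ha)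
  have hq' : (1 : ℝ) < q := by exact_mod_cast hq
  filter_upwards [ae_eventually_notMem hsum, hW.cont] with ω hω hc
  refine eventually_div_sqrt_le_chungRatio hc hq
    (mul_nonneg (by linarith) (by positivity)) (eventually_of_eventually_succ ?_)
  filter_upwards [hω, (tendsto_add_atTop_iff_nat 1).2
    (tendsto_pow_atTop_atTop_of_one_lt hq') |>.eventually_gt_atTop (Real.exp 1)] with n hn hlarge
  by_contra! hlt
  exact hn ⟨by omega, hlarge, hlt⟩

/-! ### The upper bound of the limit inferior -/

lemma measurableSet_shift_dyadicBelow (t₀ T : ℝ≥0) (R : ℝ) :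
    MeasurableSet {f : ℝ≥0 → ℝ | (fun s => f (t₀ + s) - f t₀) ∈ dyadicBelow T R} :=
  (measurableSet_dyadicBelow T R).preimage (by fun_prop)

/-- Events that concern the increments over disjoint consecutive intervals multiply, here for
the absence of all the small ball events from `m` up to `M`. -/
lemma measureReal_forall_notMem_succ (hW : IsPreBrownianReal W P) {t : ℕ → ℝ≥0} (ht : Monotone t)
    (R : ℕ → ℝ) (m M : ℕ) (hmM : m ≤ M) :
    P.real {ω | ∀ j, m ≤ j → j < M + 1 →
      (fun s => W (t j + s) ω - W (t j) ω) ∉ dyadicBelow (t (j + 1) - t j) (R j)} =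
    P.real {ω | ∀ j, m ≤ j → j < M →
      (fun s => W (t j + s) ω - W (t j) ω) ∉ dyadicBelow (t (j + 1) - t j) (R j)} *
      (1 - P.real {ω | (fun s => W (t M + s) ω - W (t M) ω) ∈
        dyadicBelow (t (M + 1) - t M) (R M)}) := by
  have := hW.isGaussianProcess.isProbabilityMeasure
  -- a path on `[0, t M]`, extended by its final value
  let g : (Set.Iic (t M) → ℝ) → (ℝ≥0 → ℝ) := fun f s => f ⟨min s (t M), Set.mem_Iic.2 (min_le_right _ _)⟩
  have hg : Measurable g := by fun_prop
  let A : Set (Set.Iic (t M) → ℝ) := {f | ∀ j, m ≤ j → j < M →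
    (fun s => g f (t j + s) - g f (t j)) ∉ dyadicBelow (t (j + 1) - t j) (R j)}
  have hA : MeasurableSet A := by
    simp only [A, Set.ofPred_forall]
    exact .iInter fun j => .iInter fun _ => .iInter fun _ =>
      ((measurableSet_shift_dyadicBelow _ _ _).preimage hg).compl
  have hA' : {ω | ∀ j, m ≤ j → j < M →
      (fun s => W (t j + s) ω - W (t j) ω) ∉ dyadicBelow (t (j + 1) - t j) (R j)}
      = (fun ω (s : Set.Iic (t M)) => W s ω) ⁻¹' A := by
    ext ω
    simp only [A, Set.mem_ofPred_eq, Set.mem_preimage]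
    refine forall_congr' fun j => forall_congr' fun _ => forall_congr' fun hj => not_congr ?_
    simp only [dyadicBelow, Set.mem_ofPred_eq]
    refine forall_congr' fun i => forall_congr' fun k => forall_congr' fun hk => ?_
    have h1 : t j + dyadicTime (t (j + 1) - t j) i k ≤ t M := calc
      _ ≤ t j + (t (j + 1) - t j) := by gcongr; exact dyadicTime_le hk
      _ = t (j + 1) := add_tsub_cancel_of_le (ht j.le_succ)
      _ ≤ t M := ht hj
    simp only [g, min_eq_left h1, min_eq_left (ht hj.le)]
  set G := {ω | (fun s => W (t M + s) ω - W (t M) ω) ∈ dyadicBelow (t (M + 1) - t M) (R M)}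
  have hG : NullMeasurableSet G P := nullMeasurableSet_dyadicBelow (hW.shift (t M)) _ _
  have hsplit : {ω | ∀ j, m ≤ j → j < M + 1 →
      (fun s => W (t j + s) ω - W (t j) ω) ∉ dyadicBelow (t (j + 1) - t j) (R j)} =
      Gᶜ ∩ (fun ω (s : Set.Iic (t M)) => W s ω) ⁻¹' A := by
    rw [← hA']
    ext ω
    constructor
    · exact fun h => ⟨h M hmM M.lt_succ_self, fun j h1 h2 => h j h1 (h2.trans M.lt_succ_self)⟩
    · rintro ⟨h1, h2⟩ j hj1 hj2
      rcases Nat.lt_succ_iff_lt_or_eq.1 hj2 with hj | rfl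
      exacts [h2 j hj1 hj, h1]
  have hcompl : P.real Gᶜ = 1 - P.real G := by
    rw [measureReal_def, prob_compl_eq_one_sub₀ hG,
      ENNReal.toReal_sub_of_le prob_le_one ENNReal.one_ne_top]
    rfl
  rw [hsplit, hA', ← hcompl, mul_comm, measureReal_def, measureReal_def, measureReal_def,
    ← ENNReal.toReal_mul]
  congr 1
  exact (hW.indepFun_shift (t M)).measure_inter_preimage_eq_mul _ A
    (measurableSet_dyadicBelow (t (M + 1) - t M) (R M)).compl hA

/-- The divergence half of the Borel–Cantelli lemma for small balls of increments over consecutive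
intervals. -/
lemma ae_frequently_mem_dyadicBelow (hW : IsPreBrownianReal W P) {t : ℕ → ℝ≥0} (ht : Monotone t)
    (R : ℕ → ℝ) {N : ℕ} (h : ∀ n ≥ N, 1 / ((n : ℝ) + 1) ≤
      P.real {ω | (fun s => W (t n + s) ω - W (t n) ω) ∈ dyadicBelow (t (n + 1) - t n) (R n)}) :
    ∀ᵐ ω ∂P, ∃ᶠ n in atTop,
      (fun s => W (t n + s) ω - W (t n) ω) ∈ dyadicBelow (t (n + 1) - t n) (R n) := by
  have := hW.isGaussianProcess.isProbabilityMeasure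
  let F : ℕ → ℕ → Set Ω := fun m M => {ω | ∀ j, m ≤ j → j < M →
      (fun s => W (t j + s) ω - W (t j) ω) ∉ dyadicBelow (t (j + 1) - t j) (R j)}
  let H : ℕ → ℝ := fun M => ∑ i ∈ Finset.range M, 1 / ((i : ℝ) + 1)
  have hbound : ∀ m ≥ N, ∀ M ≥ m, P.real (F m M) ≤ Real.exp (H m - H M) := by
    intro m hm M hM
    induction M, hM using Nat.le_induction with
    | base => simp
    | succ M hM ih =>
      have h1 := h M (hm.trans hM)
      have h2 : F m (M + 1) = {ω | ∀ j, m ≤ j → j < M + 1 →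
        (fun s => W (t j + s) ω - W (t j) ω) ∉ dyadicBelow (t (j + 1) - t j) (R j)} := rfl
      have h3 : H (M + 1) = H M + 1 / ((M : ℝ) + 1) := Finset.sum_range_succ _ _
      rw [h2, measureReal_forall_notMem_succ hW ht R m M hM, h3, ← sub_sub, sub_eq_add_neg (_ - _),
        Real.exp_add]
      refine mul_le_mul ih ?_ (sub_nonneg.2 measureReal_le_one) (Real.exp_pos _).le
      have h4 := Real.add_one_le_exp (-(1 / ((M : ℝ) + 1)))
      linarith
  have hnull : ∀ m ≥ N, P (⋂ M, F m M) = 0 := by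
    intro m hm
    have hlim : Tendsto (fun M => Real.exp (H m - H M)) atTop (nhds 0) :=
      Real.tendsto_exp_atBot.comp
        (tendsto_atBot_add_const_left _ _ (tendsto_neg_atTop_atBot.comp
          Real.tendsto_sum_range_one_div_nat_succ_atTop))
    have h0 : P.real (⋂ M, F m M) ≤ 0 := ge_of_tendsto hlim (by
      filter_upwards [eventually_ge_atTop m] with M hM
      exact (measureReal_mono (Set.iInter_subset _ M)).trans (hbound m hm M hM))
    exact (measureReal_eq_zero_iff).1 (le_antisymm h0 measureReal_nonneg)
  have hall : ∀ᵐ ω ∂P, ∀ m : ℕ, ω ∉ ⋂ M, F (m + N) M :=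
    ae_all_iff.2 fun m => measure_eq_zero_iff_ae_notMem.1 (hnull (m + N) (Nat.le_add_left _ _))
  filter_upwards [hall] with ω hω
  rw [frequently_atTop]
  intro m
  have := hω m
  simp only [F, Set.mem_iInter, Set.mem_ofPred_eq, not_forall, not_not] at this
  obtain ⟨M, j, hj, -, hmem⟩ := this
  exact ⟨j, by omega, hmem⟩

/-- The times `exp (n ^ b)`. -/
noncomputable def expTime (b : ℝ) (n : ℕ) : ℝ≥0 := ⟨Real.exp ((n : ℝ) ^ b), (Real.exp_pos _).le⟩

@[simp] lemma coe_expTime (b : ℝ) (n : ℕ) : (expTime b n : ℝ) = Real.exp ((n : ℝ) ^ b) := rfl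

lemma monotone_expTime {b : ℝ} (hb : 0 ≤ b) : Monotone (expTime b) := fun i j hij => by
  rw [← NNReal.coe_le_coe, coe_expTime, coe_expTime]
  gcongr

lemma tendsto_expTime {b : ℝ} (hb : 0 < b) : Tendsto (expTime b) atTop atTop := by
  rw [← NNReal.tendsto_coe_atTop]
  exact Real.tendsto_exp_atTop.comp ((tendsto_rpow_atTop hb).comp tendsto_natCast_atTop_atTop)

lemma exp_one_lt_expTime {b : ℝ} (hb : 0 < b) {n : ℕ} (hn : 1 ≤ n) :
    Real.exp 1 < expTime b (n + 1) := by
  rw [coe_expTime, Real.exp_lt_exp]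
  refine Real.one_lt_rpow ?_ hb
  push_cast
  have : (1 : ℝ) ≤ n := by exact_mod_cast hn
  linarith

/-- The times `expTime b` grow so fast that `t_n / (t_{n+1} / ln ln t_{n+1})` is summable. -/
lemma summable_expTime_ratio {b : ℝ} (hb : 1 < b) :
    Summable fun n : ℕ => (expTime b n : ℝ) /
      ((expTime b (n + 1) : ℝ) / Real.log (Real.log (expTime b (n + 1) : ℝ))) := by
  have hδ : 0 < b - 1 := by linarith
  -- `exp (-x) = o(x ^ (-3 / (b - 1)))` at `x = n ^ (b - 1)` gives the order `n ^ (-3)`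
  have hlit := (isLittleO_exp_neg_mul_rpow_atTop one_pos (-3 / (b - 1))).comp_tendsto
    ((tendsto_rpow_atTop hδ).comp tendsto_natCast_atTop_atTop)
  have hev := hlit.bound one_pos
  have hs : Summable fun n : ℕ => b * (n : ℝ) ^ (-2 : ℝ) :=
    (Real.summable_nat_rpow.2 (by norm_num)).mul_left b
  refine hs.of_norm_bounded_eventually_nat ?_
  filter_upwards [hev, eventually_ge_atTop 1] with n hn hn1
  have hn0 : (1 : ℝ) ≤ n := by exact_mod_cast hn1
  have hnpos : (0 : ℝ) < n := by linarith
  simp only [Function.comp_apply, one_mul, Real.norm_eq_abs] at hn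
  rw [abs_of_pos (Real.exp_pos _), neg_one_mul, abs_of_nonneg (by positivity), ← Real.rpow_mul hnpos.le,
    mul_div_cancel₀ _ hδ.ne'] at hn
  have hlog : Real.log (Real.log (expTime b (n + 1) : ℝ)) = b * Real.log (n + 1) := by
    rw [coe_expTime, Real.log_exp, Real.log_rpow (by positivity)]
    push_cast
    rfl
  have hlog0 : 0 ≤ Real.log ((n : ℝ) + 1) := Real.log_nonneg (by linarith)
  have hlog1 : Real.log ((n : ℝ) + 1) ≤ n := by
    have := Real.log_le_sub_one_of_pos (x := (n : ℝ) + 1) (by positivity)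
    linarith
  -- Bernoulli's inequality for `(1 + 1 / n) ^ b`
  have hbern : (n : ℝ) ^ b + (n : ℝ) ^ (b - 1) ≤ ((n : ℝ) + 1) ^ b := by
    have h1 := one_add_mul_self_le_rpow_one_add (s := 1 / (n : ℝ)) (p := b)
      (by linarith [one_div_pos.2 hnpos]) hb.le
    have h2 : (n : ℝ) + 1 = n * (1 + 1 / n) := by field_simp
    rw [h2, Real.mul_rpow hnpos.le (by positivity), Real.rpow_sub_one hnpos.ne']
    have h3 : (n : ℝ) ^ b * (1 + b * (1 / n)) ≤ (n : ℝ) ^ b * (1 + 1 / n) ^ b := by gcongr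
    refine le_trans ?_ h3
    have h4 : 0 ≤ (n : ℝ) ^ b / n := by positivity
    have h5 : (n : ℝ) ^ b * (1 + b * (1 / n)) = (n : ℝ) ^ b + b * ((n : ℝ) ^ b / n) := by ring
    rw [h5]
    nlinarith
  rw [hlog, coe_expTime, coe_expTime, div_div_eq_mul_div, mul_div_right_comm, ← Real.exp_sub,
    Real.norm_of_nonneg (by positivity)]
  push_cast
  calc Real.exp ((n : ℝ) ^ b - ((n : ℝ) + 1) ^ b) * (b * Real.log (n + 1))
      ≤ Real.exp (-(n : ℝ) ^ (b - 1)) * (b * n) := by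
        gcongr
        linarith
    _ ≤ (n : ℝ) ^ (-3 : ℝ) * (b * n) := by
        gcongr
    _ = b * ((n : ℝ) ^ (-3 : ℝ) * (n : ℝ) ^ (1 : ℝ)) := by
        rw [Real.rpow_one]
        ring
    _ = b * (n : ℝ) ^ (-2 : ℝ) := by
        rw [← Real.rpow_add hnpos]
        norm_num

/-- The path up to `expTime b n` is negligible at the scale of `expTime b (n + 1)`. -/
lemma ae_eventually_runningSup_expTime_le (hW : IsBrownianReal W P) {b η : ℝ} (hb : 1 < b)
    (hη : 0 < η) :
    ∀ᵐ ω ∂P, ∀ᶠ n in atTop, runningSup W (expTime b n) ω ≤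
      η * √((expTime b (n + 1) : ℝ) / Real.log (Real.log (expTime b (n + 1) : ℝ))) := by
  have := hW.isGaussianProcess.isProbabilityMeasure
  have hb0 : 0 < b := by linarith
  let S : ℕ → ℝ := fun n => (expTime b (n + 1) : ℝ) / Real.log (Real.log (expTime b (n + 1) : ℝ))
  let E : ℕ → Set Ω := fun n => {ω | (W · ω) ∈ dyadicBelow (expTime b n) (η * √(S n))}
  have hSpos : ∀ n ≥ 1, 0 < S n := fun n hn => by
    have h1 := exp_one_lt_expTime hb0 hn
    have h0 : (0 : ℝ) < expTime b (n + 1) := (Real.exp_pos 1).trans h1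
    exact div_pos h0 (Real.log_pos ((Real.lt_log_iff_exp_lt h0).2 h1))
  have hE : ∀ n ≥ 1, P (E n)ᶜ ≤
      ENNReal.ofReal (Real.pi ^ 2 / (8 * η ^ 2) * ((expTime b n : ℝ) / S n)) := fun n hn => by
    have hR : 0 < η * √(S n) := mul_pos hη (Real.sqrt_pos.2 (hSpos n hn))
    have h1 := exp_le_measureReal_dyadicBelow hW (expTime b n) hR
    have h2 := Real.add_one_le_exp (-(Real.pi ^ 2 * (expTime b n : ℝ) / (8 * (η * √(S n)) ^ 2)))
    rw [← ofReal_measureReal]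
    refine ENNReal.ofReal_le_ofReal ?_
    have hEm : NullMeasurableSet (E n) P :=
      nullMeasurableSet_dyadicBelow hW.toIsPreBrownianReal _ _
    have hcompl : P.real (E n)ᶜ = 1 - P.real (E n) := by
      rw [measureReal_def, prob_compl_eq_one_sub₀ hEm,
        ENNReal.toReal_sub_of_le prob_le_one ENNReal.one_ne_top]
      rfl
    have h3 : Real.pi ^ 2 * (expTime b n : ℝ) / (8 * (η * √(S n)) ^ 2)
        = Real.pi ^ 2 / (8 * η ^ 2) * ((expTime b n : ℝ) / S n) := by
      rw [mul_pow, Real.sq_sqrt (hSpos n hn).le, div_mul_div_comm]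
      ring
    rw [hcompl, ← h3]
    linarith
  have hsum : ∑' n, P (E (n + 1))ᶜ ≠ ∞ := by
    refine ne_top_of_le_ne_top ?_ (ENNReal.tsum_le_tsum fun n => hE (n + 1) (by omega))
    have := (summable_nat_add_iff 1).2
      ((summable_expTime_ratio hb).mul_left (Real.pi ^ 2 / (8 * η ^ 2)))
    exact this.tsum_ofReal_ne_top
  filter_upwards [ae_eventually_notMem hsum, hW.cont] with ω hω hc
  refine eventually_of_eventually_succ ?_
  filter_upwards [hω] with n hn
  exact runningSup_le_of_mem_dyadicBelow hc (not_not.1 hn)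

/-- The bound holds along the times `t = expTime b (n + 1)` with `b = r²`, a choice for which the
increments over `[expTime b n, t]` stay below `r (π / √8) √(t / ln ln t)` with probability at least
`1 / (n + 1)`, a divergent series. -/
lemma ae_frequently_chungRatio_le (hW : IsBrownianReal W P) {r η : ℝ} (hr : 1 < r) (hη : 0 < η) :
    ∀ᵐ ω ∂P, ∃ᶠ t : ℝ≥0 in atTop, chungRatio W t ω ≤ r * (Real.pi / √8) + η := by
  have := hW.isGaussianProcess.isProbabilityMeasure
  set b := r ^ 2 with hbdef
  have hb : 1 < b := one_lt_pow₀ hr two_ne_zero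
  have hb0 : 0 < b := by linarith
  have ht := monotone_expTime hb0.le
  let S : ℕ → ℝ := fun n => (expTime b (n + 1) : ℝ) / Real.log (Real.log (expTime b (n + 1) : ℝ))
  have hSpos : ∀ n ≥ 1, 0 < √(S n) := fun n hn => by
    have h1 := exp_one_lt_expTime hb0 hn
    have h0 : (0 : ℝ) < expTime b (n + 1) := (Real.exp_pos 1).trans h1
    exact Real.sqrt_pos.2 (div_pos h0 (Real.log_pos ((Real.lt_log_iff_exp_lt h0).2 h1)))
  have hprob : ∀ n ≥ (1 : ℕ), 1 / ((n : ℝ) + 1) ≤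
      P.real {ω | (fun s => W (expTime b n + s) ω - W (expTime b n) ω) ∈
        dyadicBelow (expTime b (n + 1) - expTime b n) (r * (Real.pi / √8) * √(S n))} :=
      fun n hn => by
    have hR : 0 < r * (Real.pi / √8) * √(S n) := by
      have := hSpos n hn
      positivity
    refine le_trans ?_ (exp_le_measureReal_dyadicBelow (hW.shift (expTime b n))
      (expTime b (n + 1) - expTime b n) hR)
    have h1 := exp_neg_chung_exponent (exp_one_lt_expTime hb0 hn) (by linarith : 0 < r)
    have h2 : Real.log (expTime b (n + 1) : ℝ) ^ (-(1 / r ^ 2)) = 1 / ((n : ℝ) + 1) := by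
      rw [coe_expTime, Real.log_exp, ← Real.rpow_mul (by positivity), ← hbdef,
        show b * -(1 / b) = -1 by field_simp, Real.rpow_neg_one]
      push_cast
      rw [one_div]
    rw [← h2, ← h1, Real.exp_le_exp, neg_le_neg_iff]
    gcongr
    exact tsub_le_self
  filter_upwards [ae_frequently_mem_dyadicBelow hW.toIsPreBrownianReal ht _ hprob,
    ae_eventually_runningSup_expTime_le hW hb (half_pos hη), hW.cont] with ω hfreq hev hc
  refine ((tendsto_expTime hb0).comp (tendsto_add_atTop_nat 1)).frequently ?_
  refine (hfreq.and_eventually (hev.and (eventually_ge_atTop 1))).mono ?_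
  rintro n ⟨h1, h2, hn⟩
  simp only [Function.comp_apply]
  rw [chungRatio, div_le_iff₀ (hSpos n hn)]
  have hc' : Continuous fun s => W (expTime b n + s) ω - W (expTime b n) ω := by fun_prop
  refine runningSup_le fun s hs => ?_
  have hS := hSpos n hn
  have hpos : 0 ≤ r * (Real.pi / √8) * √(S n) := by positivity
  rcases le_total s (expTime b n) with hsn | hsn
  · have h3 := le_runningSup hc hsn
    change _ ≤ (r * (Real.pi / √8) + η) * √(S n)
    change _ ≤ η / 2 * √(S n) at h2
    nlinarith
  · obtain ⟨u, rfl⟩ := exists_add_of_le hsn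
    have hu : u ≤ expTime b (n + 1) - expTime b n :=
      le_tsub_of_add_le_left hs
    have h3 := abs_le_of_mem_dyadicBelow hc' h1 hu
    have h4 := le_runningSup hc (le_refl (expTime b n))
    have h5 := abs_sub_abs_le_abs_sub (W (expTime b n + u) ω) (W (expTime b n) ω)
    change _ ≤ (r * (Real.pi / √8) + η) * √(S n)
    change _ ≤ η / 2 * √(S n) at h2
    nlinarith

/-- **Chung's law of the iterated logarithm** for Brownian motion. -/
lemma ae_liminf_chungRatio_eq (hW : IsBrownianReal W P) :
    ∀ᵐ ω ∂P, liminf (fun t : ℝ≥0 => ((chungRatio W t ω : ℝ) : EReal)) atTop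
      = ((Real.pi / √8 : ℝ) : EReal) := by
  have hδ : ∀ j : ℕ, 0 < 1 / ((j : ℝ) + 2) ∧ 1 / ((j : ℝ) + 2) < 1 := fun j =>
    ⟨by positivity, by
      rw [div_lt_one (by positivity)]
      linarith [(Nat.cast_nonneg j : (0 : ℝ) ≤ j)]⟩
  let q : ℕ → ℝ≥0 := fun j => 1 + 1 / ((j : ℝ≥0) + 2)
  have hq : ∀ j, 1 < q j := fun j => lt_add_of_pos_right _ (by positivity)
  have hlim : Tendsto (fun j : ℕ => 1 / ((j : ℝ) + 2)) atTop (nhds 0) := by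
    have := (tendsto_add_atTop_iff_nat 1).2 (tendsto_one_div_add_atTop_nhds_zero_nat (𝕜 := ℝ))
    refine this.congr fun j => ?_
    push_cast
    ring_nf
  have hlow := ae_all_iff.2 fun j : ℕ =>
    ae_eventually_le_chungRatio hW (hq j) (hδ j).1 (hδ j).2
  have hupp := ae_all_iff.2 fun j : ℕ =>
    ae_frequently_chungRatio_le hW (r := 1 + 1 / ((j : ℝ) + 2)) (by linarith [(hδ j).1]) (hδ j).1
  filter_upwards [hlow, hupp] with ω h1 h2
  have hcoe := continuous_coe_real_ereal.tendsto (Real.pi / √8)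
  refine le_antisymm ?_ ?_
  · have hl : Tendsto (fun j : ℕ => (1 + 1 / ((j : ℝ) + 2)) * (Real.pi / √8) + 1 / ((j : ℝ) + 2))
        atTop (nhds (Real.pi / √8)) := by
      have := ((hlim.const_add 1).mul_const (Real.pi / √8)).add hlim
      simpa using this
    refine ge_of_tendsto' (hcoe.comp hl) fun j => ?_
    exact liminf_le_of_frequently_le' ((h2 j).mono fun t ht => EReal.coe_le_coe_iff.2 ht)
  · have hl : Tendsto (fun j : ℕ => (1 - 1 / ((j : ℝ) + 2)) * (Real.pi / √8) / √(q j : ℝ))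
        atTop (nhds (Real.pi / √8)) := by
      have hq' : Tendsto (fun j => √(q j : ℝ)) atTop (nhds 1) := by
        have h3 : Tendsto (fun j => (q j : ℝ)) atTop (nhds 1) := by
          have := hlim.const_add 1
          simpa [q] using this
        simpa using h3.sqrt
      have := ((hlim.const_sub 1).mul_const (Real.pi / √8)).div hq' one_ne_zero
      simpa [Pi.div_def] using this
    refine le_of_tendsto' (hcoe.comp hl) fun j => ?_
    exact le_liminf_of_le (by isBoundedDefault)
      ((h1 j).mono fun t ht => EReal.coe_le_coe_iff.2 ht)

end

theorem theorem2 {Ω : Type*} [MeasurableSpace Ω] (P : Measure Ω) (W : ℝ≥0 → Ω → ℝ)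
    (hW : IsBrownianReal W P) :
    (∀ᵐ ω ∂P, liminf (fun t : ℝ≥0 => ((chungRatio W t ω : ℝ) : EReal)) atTop
      = ((Real.pi / Real.sqrt 8 : ℝ) : EReal)) ∧
    (∀ (q : ℝ≥0) (ε p : ℝ) (k : ℕ), 1 < q → 0 < ε → ε ≠ 1 → p < 1 / (1 - ε) ^ 2 - 1 → 1 ≤ k →
      P {ω | (k : ℕ∞) ≤ deviationCount W q ε ω}
          ≤ ENNReal.ofReal (24 / (5 * Real.pi * Real.log (q : ℝ) ^ (1 / (1 - ε) ^ 2)))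
            * max (zetaSeries (1 / (1 - ε) ^ 2 - p - 1)
                    / ENNReal.ofReal ((1 - ε) ^ 2 * (k : ℝ) ^ (p + 1)))
                  (zetaSeries (1 / (1 - ε) ^ 2) / (k : ℝ≥0∞)) ∧
      (-1 < p →
        P {ω | (k : ℕ∞) ≤ deviationCount W q ε ω}
          ≤ ENNReal.ofReal (24 / (5 * Real.pi * Real.log (q : ℝ) ^ (1 / (1 - ε) ^ 2)))
            * min (zetaSeries (1 / (1 - ε) ^ 2 - p - 1)
                    / ENNReal.ofReal ((1 - ε) ^ 2 * (k : ℝ) ^ (p + 1)))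
                  (zetaSeries (1 / (1 - ε) ^ 2) / (k : ℝ≥0∞)))) := by
  refine ⟨ae_liminf_chungRatio_eq hW, fun q ε p k hq hε0 hε1 _ hk => ?_⟩
  rcases lt_or_gt_of_ne hε1 with hε | hε
  · have hzeta := measure_le_deviationCount_le hW hq hε hk
    refine ⟨hzeta.trans ?_, fun hp => ?_⟩
    · gcongr
      exact le_max_right _ _
    · rw [← min_mul_mul_left]
      exact le_min (measure_le_deviationCount_le' hW hq hε0 hε hp hk) hzeta
  · rw [measure_le_deviationCount_of_one_lt q hε hk]
    exact ⟨zero_le, fun _ => zero_le⟩
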